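/- Consider a finite directed graph $(\mathcal V,\mathcal E)$ with average link capacities $C_{ij}$ and unit transmission costs $e_{ij}$, a destination $d\in\mathcal V$, a maximal lifetime $L$ (lifetimes are $\mathcal L=\{1,\dots,L\}$) and a reliability level $\gamma$. In slot $t=0,1,2,\dots$, $a_i^{(l)}(t)\ge 0$ packets of lifetime $l\in\mathcal L$ arrive at node $i$, with $a_d^{(l)}(t)=0$; the vectors $a(t)$ are bounded and i.i.d. over $t$, with means $\lambda_i^{(l)}$, and $\|\lambda\|_1=\sum_{i,l}\lambda_i^{(l)}$. A (possibly randomized) policy chooses real flows $x_{ij}^{(l)}(t)\ge0$, $(i,j)\in\mathcal E$, $l\in\mathcal L$, before the arrivals of slot $t$ are received and without anticipating them: the decisions up to slot $t$ and the arrivals before slot $t$ are jointly independent of the arrivals from slot $t$ on. Write $x_{i\to}^{(l)}=\sum_{j:(i,j)\in\mathcal E}x_{ij}^{(l)}$, $x_{\to i}^{(l)}=\sum_{j:(j,i)\in\mathcal E}x_{ji}^{(l)}$, $x_{ij}=\sum_{l\in\mathcal L}x_{ij}^{(l)}$, $x_{\to d}=\sum_{l\in\mathcal L}x_{\to d}^{(l)}$,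 let a superscript $(\ge l)$ denote summation over the lifetimes $\ell$ with $l\le\ell\le L$, let $h(x)=\sum_{(i,j)\in\mathcal E}e_{ij}x_{ij}$, and let $\overline{z(t)}=\lim_{T\to\infty}\frac1T\sum_{t=0}^{T-1}z(t)$. Policies are required to have a flow assignment, that is, all limits $\overline{\mathbb E\,x_{ij}^{(l)}(t)}$ exist. Problem $\mathscr P_1$: minimize $\overline{\mathbb E\,h(x(t))}$ over the policies with $\overline{\mathbb E\,x_{\to d}(t)}\ge\gamma\|\lambda\|_1$, $\overline{\mathbb E\,x_{ij}(t)}\le C_{ij}$ for all $(i,j)\in\mathcal E$, and $x_{i\to}^{(l)}(t)\le Q_i^{(l)}(t)$ for all $i\in\mathcal V$, $l\in\mathcal L$, $t\ge0$. Here, for $i\ne d$ and $l\in\mathcal L$, $Q_i^{(l)}(t+1)=Q_i^{(l+1)}(t)-x_{i\to}^{(l+1)}(t)+x_{\to i}^{(l+1)}(t)+a_i^{(l)}(t)$ from an arbitrary deterministic initial backlog $Q_i^{(l)}(0)\ge0$, all quantities of lifetime $L+1$ are zero, and $Q_i^{(0)}(t)=0$, $Q_d^{(l)}(t)=0$. Problem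 $\mathscr P_2$: minimize $\overline{\mathbb E\,h(x(t))}$ over the policies with $\overline{\mathbb E\,x_{\to d}(t)}\ge\gamma\|\lambda\|_1$, $x_{ij}(t)\le C_{ij}$ for all $(i,j)\in\mathcal E$ and $t\ge0$, $\overline{\mathbb E\,x_{i\to}^{(\ge l)}(t)}\le\overline{\mathbb E\,x_{\to i}^{(\ge l+1)}(t)}+\lambda_i^{(\ge l)}$ for all $i\in\mathcal V$, $l\in\mathcal L$, and $x_{dk}^{(l)}(t)=0$ for all $(d,k)\in\mathcal E$, $l\in\mathcal L$, $t\ge0$ (the destination sends nothing). Then $\mathscr P_1$ and $\mathscr P_2$ have the same optimal value: the infima of the achieved long-term average costs coincide (both are $+\infty$ if one of the problems is infeasible), and a number is the minimum achieved cost of $\mathscr P_1$ if and only if it is the minimum achieved cost of $\mathscr P_2$. -/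

import Mathlib

open MeasureTheory ProbabilityTheory Filter Topology

/-- A packet routing network with a single commodity: links (a finite directed graph), average
link capacities, unit transmission costs, destination and maximal lifetime. -/
structure RoutingNetwork (V : Type*) where
  /-- the set of directed links `(i, j)` -/
  links : Finset (V × V)
  /-- the average transmission capacity `C i j` of link `(i, j)` -/
  C : V → V → ℝ
  /-- the cost `e i j` of sending one unit of data over link `(i, j)` -/
  e : V → V → ℝ
  /-- the destination node -/
  d : V
  /-- the maximal lifetime; lifetimes are `1, …, L` -/
  L : ℕ

/-- Flow variables: `x i j l` is the amount of lifetime-`l` packets sent from `i` to `j`. -/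
abbrev FlowVar (V : Type*) := V → V → ℕ → ℝ

/-- `z` has long-term average `c`, i.e. `lim_{T → ∞} (1 / T) ∑_{t < T} z t` exists and is `c`. -/
def HasLongTermAvg (z : ℕ → ℝ) (c : ℝ) : Prop :=
  Tendsto (fun T : ℕ => (1 / (T : ℝ)) * ∑ t ∈ Finset.range T, z t) atTop (𝓝 c)

namespace RoutingNetwork

variable {V : Type*} [Fintype V] [DecidableEq V] (N : RoutingNetwork V)
variable {Ω : Type*} [MeasurableSpace Ω]

/-- Total outgoing lifetime-`l` flow of node `i`. -/
def outflow (x : FlowVar V) (i : V) (l : ℕ) : ℝ :=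
  ∑ j ∈ Finset.univ.filter (fun j => (i, j) ∈ N.links), x i j l

/-- Total incoming lifetime-`l` flow of node `i`. -/
def inflow (x : FlowVar V) (i : V) (l : ℕ) : ℝ :=
  ∑ j ∈ Finset.univ.filter (fun j => (j, i) ∈ N.links), x j i l

/-- Sum over all lifetimes `ℓ` with `l ≤ ℓ ≤ L`. -/
def sumGE (f : ℕ → ℝ) (l : ℕ) : ℝ := ∑ k ∈ Finset.Icc l N.L, f k

/-- Flow `x i j` over link `(i, j)`, all lifetimes together. -/
def linkFlow (x : FlowVar V) (i j : V) : ℝ := ∑ l ∈ Finset.Icc 1 N.L, x i j l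

/-- Flow of effective packets into the destination. -/
def delivered (x : FlowVar V) : ℝ := ∑ l ∈ Finset.Icc 1 N.L, N.inflow x N.d l

/-- Instantaneous cost of a decision. -/
def cost (x : FlowVar V) : ℝ := ∑ p ∈ N.links, N.e p.1 p.2 * N.linkFlow x p.1 p.2

/-- `a t ω i l` is the number of lifetime-`l` packets arriving at node `i` in slot `t`: bounded,
i.i.d. over time (as a vector indexed by nodes and lifetimes; different nodes and lifetimes may be
dependent), with no arrivals at the destination and lifetimes in `1, …, L` only. -/
structure IsArrivals (μ : Measure Ω) (a : ℕ → Ω → V → ℕ → ℝ) : Prop where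
  measurable : ∀ t, Measurable (a t)
  nonneg : ∀ t ω i l, 0 ≤ a t ω i l
  bounded : ∃ Amax : ℝ, ∀ t ω i l, a t ω i l ≤ Amax
  dest : ∀ t ω l, a t ω N.d l = 0
  lifetime : ∀ t ω i l, l ∉ Finset.Icc 1 N.L → a t ω i l = 0
  indep : iIndepFun a μ
  ident : ∀ t, IdentDistrib (a t) (a 0) μ μ

/-- Mean arrival rate of lifetime-`l` packets at node `i` (the same for all slots). -/
noncomputable def rate (μ : Measure Ω) (a : ℕ → Ω → V → ℕ → ℝ) (i : V) (l : ℕ) : ℝ :=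
  ∫ ω, a 0 ω i l ∂μ

/-- Total arrival rate, the 1-norm of the arrival vector. -/
noncomputable def totalRate (μ : Measure Ω) (a : ℕ → Ω → V → ℕ → ℝ) : ℝ :=
  ∑ i, ∑ l ∈ Finset.Icc 1 N.L, |rate μ a i l|

/-- Queue backlogs `Q t i l` along one sample path with initial backlog `q₀`, arrivals `a` and
decisions `x`. Packets get one slot older in each slot, outdated packets are dropped, packets that
reach the destination are consumed, and there are no packets of lifetime greater than `L`. -/
def queue (q₀ : V → ℕ → ℝ) (a : ℕ → V → ℕ → ℝ) (x : ℕ → FlowVar V) : ℕ → V → ℕ → ℝ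
  | 0, i, l => if i = N.d ∨ l ∉ Finset.Icc 1 N.L then 0 else q₀ i l
  | t + 1, i, l =>
      if i = N.d ∨ l ∉ Finset.Icc 1 N.L then 0
      else queue q₀ a x t i (l + 1) - N.outflow (x t) i (l + 1)
        + N.inflow (x t) i (l + 1) + a t i l

/-- A (possibly randomized) control policy, as the process of its decisions: nonnegative flows on
the links, for lifetimes in `1, …, L`. Decisions do not anticipate: past arrivals and decisions up
to and including slot `t` are independent of the arrivals in slots `t, t + 1, …` (the arrivals of
slot `t` come in after the decision of slot `t`). -/
structure IsPolicy (μ : Measure Ω) (a : ℕ → Ω → V → ℕ → ℝ) (x : ℕ → Ω → FlowVar V) : Prop where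
  measurable : ∀ t, Measurable (x t)
  nonneg : ∀ t ω i j l, 0 ≤ x t ω i j l
  support : ∀ t ω i j l, (i, j) ∉ N.links ∨ l ∉ Finset.Icc 1 N.L → x t ω i j l = 0
  nonanticipating : ∀ t,
    Indep ((⨆ s, ⨆ (_ : s ≤ t), MeasurableSpace.comap (x s) inferInstance) ⊔
        (⨆ s, ⨆ (_ : s < t), MeasurableSpace.comap (a s) inferInstance))
      (⨆ s, ⨆ (_ : t ≤ s), MeasurableSpace.comap (a s) inferInstance) μ

/-- `f` is the flow assignment of `x`: the long-term averages of all expected flow variables. -/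
def IsFlowAssignment (μ : Measure Ω) (x : ℕ → Ω → FlowVar V) (f : FlowVar V) : Prop :=
  ∀ i j l, HasLongTermAvg (fun t => ∫ ω, x t ω i j l ∂μ) (f i j l)

/-- The reliability constraint: the timely throughput is at least `γ` times the arrival rate. -/
def Reliable (μ : Measure Ω) (a : ℕ → Ω → V → ℕ → ℝ) (γ : ℝ) (x : ℕ → Ω → FlowVar V) : Prop :=
  ∃ c, HasLongTermAvg (fun t => ∫ ω, N.delivered (x t ω) ∂μ) c ∧ γ * N.totalRate μ a ≤ c

/-- Admissible policies of the original problem. The flows are bounded in each slot because of the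
availability constraint, so all expectations are those of integrable functions. -/
structure AdmissibleOne (μ : Measure Ω) (q₀ : V → ℕ → ℝ) (a : ℕ → Ω → V → ℕ → ℝ) (γ : ℝ)
    (x : ℕ → Ω → FlowVar V) : Prop where
  policy : N.IsPolicy μ a x
  assignment : ∃ f, IsFlowAssignment μ x f
  reliability : N.Reliable μ a γ x
  capacity : ∀ i j, (i, j) ∈ N.links →
    ∃ c, HasLongTermAvg (fun t => ∫ ω, N.linkFlow (x t ω) i j ∂μ) c ∧ c ≤ N.C i j
  availability : ∀ t ω i, ∀ l ∈ Finset.Icc 1 N.L,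
    N.outflow (x t ω) i l ≤ N.queue q₀ (fun s => a s ω) (fun s => x s ω) t i l

/-- Admissible policies of the virtual network problem: the capacity constraint holds in each slot,
and the availability constraint is relaxed to causality on average. As everywhere in the model, the
destination is a sink and sends nothing. The flows are bounded because of the capacity constraint,
so all expectations are those of integrable functions. -/
structure AdmissibleTwo (μ : Measure Ω) (a : ℕ → Ω → V → ℕ → ℝ) (γ : ℝ)
    (x : ℕ → Ω → FlowVar V) : Prop where
  policy : N.IsPolicy μ a x
  assignment : ∃ f, IsFlowAssignment μ x f
  reliability : N.Reliable μ a γ x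
  capacity : ∀ t ω i j, (i, j) ∈ N.links → N.linkFlow (x t ω) i j ≤ N.C i j
  causality : ∀ i, ∀ l ∈ Finset.Icc 1 N.L, ∃ c c',
    HasLongTermAvg (fun t => ∫ ω, N.sumGE (N.outflow (x t ω) i) l ∂μ) c ∧
    HasLongTermAvg (fun t => ∫ ω, N.sumGE (N.inflow (x t ω) i) (l + 1) ∂μ) c' ∧
    c ≤ c' + N.sumGE (rate μ a i) l
  sink : ∀ t ω k l, x t ω N.d k l = 0

/-- The long-term average costs achieved by the policies in a class `A`. -/
def achievedCosts (μ : Measure Ω) (A : (ℕ → Ω → FlowVar V) → Prop) : Set ℝ :=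
  {c | ∃ x, A x ∧ HasLongTermAvg (fun t => ∫ ω, N.cost (x t ω) ∂μ) c}

/-- The optimal value over a class `A` of policies: the infimum of the achieved costs, `⊤` if there
is no admissible policy. -/
noncomputable def optimalValue (μ : Measure Ω) (A : (ℕ → Ω → FlowVar V) → Prop) : EReal :=
  sInf ((fun c : ℝ => (c : EReal)) '' N.achievedCosts μ A)

end RoutingNetwork

set_option linter.unusedSectionVars false

/-! ### Cesàro averages -/

namespace HasLongTermAvg

/-! Both problems reduce to one static linear program. Cost, reliability, mean capacity and
causality depend only on the flow assignment `f`, and each class of policies realizes exactly the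
assignments in `IsFeasibleFlow`. So both sets of achieved costs are the image of the same set under
`cost`.

From policies to feasible flows: in the virtual network the constraints are averaged. In the
original network only causality needs an argument. The expected backlog of lifetime at least `l` is
a nonnegative storage that loses at least the outflow of lifetime at least `l` and gains the inflow
of lifetime at least `l + 1` plus new arrivals, so outflow cannot exceed supply on average
(`le_of_drift`, `sumGE_queue_succ_le`).

From feasible flows to policies: the constant decision `f` serves the virtual network. In the
original network, let `q` be the steady backlog of the fluid model (`fluidQueue`) and send the
fraction `f i j l / q i l` of the actual backlog. Causality says precisely that `q` dominates the
outflow of `f`, so the fractions leaving a node sum to at most 1 and availability holds on every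
path. The dynamics are linear, so mean backlogs obey the same recursion driven by the rates.
Lifetime `l` at slot `t + 1` depends only on lifetime `l + 1` at slot `t`, and lifetime `L + 1` is
empty, so the initial state is flushed out within `L` slots; from then on the mean flow equals `f`.
-/

theorem const_mul {z : ℕ → ℝ} {c : ℝ} (h : HasLongTermAvg z c) (r : ℝ) :
    HasLongTermAvg (fun t => r * z t) (r * c) := by
  have h' := Tendsto.const_mul r h
  refine h'.congr fun T => ?_
  rw [← Finset.mul_sum]
  ring

theorem sum {ι : Type*} (s : Finset ι) {z : ι → ℕ → ℝ} {c : ι → ℝ}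
    (h : ∀ k ∈ s, HasLongTermAvg (z k) (c k)) :
    HasLongTermAvg (fun t => ∑ k ∈ s, z k t) (∑ k ∈ s, c k) := by
  have h' := tendsto_finsetSum s h
  refine h'.congr fun T => ?_
  rw [Finset.sum_comm, Finset.mul_sum]

theorem unique {z : ℕ → ℝ} {c c' : ℝ} (h : HasLongTermAvg z c) (h' : HasLongTermAvg z c') :
    c = c' :=
  tendsto_nhds_unique h h'

theorem of_tendsto {z : ℕ → ℝ} {c : ℝ} (h : Tendsto z atTop (𝓝 c)) : HasLongTermAvg z c := by
  simpa [HasLongTermAvg] using h.cesaro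

theorem of_const (c : ℝ) : HasLongTermAvg (fun _ => c) c :=
  of_tendsto tendsto_const_nhds

theorem nonneg {z : ℕ → ℝ} {c : ℝ} (h : HasLongTermAvg z c) (hz : ∀ t, 0 ≤ z t) : 0 ≤ c :=
  ge_of_tendsto' h fun _ => mul_nonneg (by positivity) (Finset.sum_nonneg fun t _ => hz t)

/-- A nonnegative storage `S` with inflow `u` and outflow at least `z` forces `z ≤ u` on average. -/
theorem le_of_drift {z u S : ℕ → ℝ} {c c' : ℝ} (hz : HasLongTermAvg z c)
    (hu : HasLongTermAvg u c') (hS : ∀ t, 0 ≤ S t) (h : ∀ t, S (t + 1) ≤ S t - z t + u t) :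
    c ≤ c' := by
  have key : ∀ T : ℕ, S T + ∑ t ∈ Finset.range T, z t ≤ S 0 + ∑ t ∈ Finset.range T, u t := by
    intro T
    induction T with
    | zero => simp
    | succ T ih =>
      rw [Finset.sum_range_succ, Finset.sum_range_succ]
      linarith [h T]
  have h0 : Tendsto (fun T : ℕ => (1 / (T : ℝ)) * S 0) atTop (𝓝 0) := by
    simpa using tendsto_one_div_atTop_nhds_zero_nat.mul_const (S 0)
  have h1 := h0.add hu
  rw [zero_add] at h1
  refine le_of_tendsto_of_tendsto' hz h1 fun T => ?_
  rw [← mul_add]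
  exact mul_le_mul_of_nonneg_left (by linarith [key T, hS T]) (by positivity)

end HasLongTermAvg

namespace RoutingNetwork

variable {V : Type*} [Fintype V] [DecidableEq V] (N : RoutingNetwork V)
variable {Ω : Type*} [MeasurableSpace Ω]

/-! ### Sums over lifetimes, and the feasible flows -/

theorem sumGE_eq_add (g : ℕ → ℝ) {l : ℕ} (hl : l ≤ N.L) :
    N.sumGE g l = g l + N.sumGE g (l + 1) := by
  unfold sumGE
  rw [← Finset.insert_Icc_succ_left_eq_Icc hl, Finset.sum_insert (by simp)]
  rfl

theorem sumGE_of_lt (g : ℕ → ℝ) {l : ℕ} (hl : N.L < l) : N.sumGE g l = 0 := by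
  simp [sumGE, Finset.Icc_eq_empty_of_lt hl]

/-- Ageing by one slot, summed over lifetimes: the only boundary term sits at lifetime `L + 1`,
where there is nothing. -/
theorem sumGE_shift (g : ℕ → ℝ) (hg : g (N.L + 1) = 0) (l : ℕ) :
    N.sumGE (fun k => g (k + 1)) l = N.sumGE g (l + 1) := by
  rcases lt_or_ge N.L l with h | h
  · rw [N.sumGE_of_lt _ h, N.sumGE_of_lt _ (by omega)]
  induction h using Nat.decreasingInduction with
  | self =>
    rw [N.sumGE_eq_add _ le_rfl, N.sumGE_of_lt _ (by omega), N.sumGE_of_lt _ (by omega), hg,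
      add_zero]
  | of_succ k hk ih => rw [N.sumGE_eq_add _ hk.le, ih, N.sumGE_eq_add g hk]

/-- The flow assignments that are feasible for the fluid model. -/
structure IsFeasibleFlow (μ : Measure Ω) (a : ℕ → Ω → V → ℕ → ℝ) (γ : ℝ) (f : FlowVar V) :
    Prop where
  nonneg : ∀ i j l, 0 ≤ f i j l
  support : ∀ i j l, (i, j) ∉ N.links ∨ l ∉ Finset.Icc 1 N.L → f i j l = 0
  reliability : γ * N.totalRate μ a ≤ N.delivered f
  capacity : ∀ i j, (i, j) ∈ N.links → N.linkFlow f i j ≤ N.C i j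
  causality : ∀ i, ∀ l ∈ Finset.Icc 1 N.L,
    N.sumGE (N.outflow f i) l ≤ N.sumGE (N.inflow f i) (l + 1) + N.sumGE (rate μ a i) l
  sink : ∀ k l, f N.d k l = 0

/-- The expected flows of a random decision. -/
noncomputable def meanFlow (μ : Measure Ω) (x : Ω → FlowVar V) : FlowVar V :=
  fun i j l => ∫ ω, x ω i j l ∂μ

/-! ### Linear functionals of the flow commute with expectation -/

section Expectations

variable {μ : Measure Ω} {x : Ω → FlowVar V}

theorem integrable_outflow (hx : ∀ i j l, Integrable (fun ω => x ω i j l) μ) (i : V) (l : ℕ) :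
    Integrable (fun ω => N.outflow (x ω) i l) μ :=
  integrable_finsetSum _ fun _ _ => hx _ _ _

theorem integrable_inflow (hx : ∀ i j l, Integrable (fun ω => x ω i j l) μ) (i : V) (l : ℕ) :
    Integrable (fun ω => N.inflow (x ω) i l) μ :=
  integrable_finsetSum _ fun _ _ => hx _ _ _

theorem integrable_linkFlow (hx : ∀ i j l, Integrable (fun ω => x ω i j l) μ) (i j : V) :
    Integrable (fun ω => N.linkFlow (x ω) i j) μ :=
  integrable_finsetSum _ fun _ _ => hx _ _ _

theorem integral_outflow (hx : ∀ i j l, Integrable (fun ω => x ω i j l) μ) (i : V) (l : ℕ) :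
    ∫ ω, N.outflow (x ω) i l ∂μ = N.outflow (meanFlow μ x) i l :=
  integral_finsetSum _ fun _ _ => hx _ _ _

theorem integral_inflow (hx : ∀ i j l, Integrable (fun ω => x ω i j l) μ) (i : V) (l : ℕ) :
    ∫ ω, N.inflow (x ω) i l ∂μ = N.inflow (meanFlow μ x) i l :=
  integral_finsetSum _ fun _ _ => hx _ _ _

theorem integral_linkFlow (hx : ∀ i j l, Integrable (fun ω => x ω i j l) μ) (i j : V) :
    ∫ ω, N.linkFlow (x ω) i j ∂μ = N.linkFlow (meanFlow μ x) i j :=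
  integral_finsetSum _ fun _ _ => hx _ _ _

theorem integral_delivered (hx : ∀ i j l, Integrable (fun ω => x ω i j l) μ) :
    ∫ ω, N.delivered (x ω) ∂μ = N.delivered (meanFlow μ x) := by
  unfold delivered
  rw [integral_finsetSum _ fun _ _ => N.integrable_inflow hx _ _]
  exact Finset.sum_congr rfl fun _ _ => N.integral_inflow hx _ _

theorem integral_cost (hx : ∀ i j l, Integrable (fun ω => x ω i j l) μ) :
    ∫ ω, N.cost (x ω) ∂μ = N.cost (meanFlow μ x) := by
  unfold cost
  rw [integral_finsetSum _ fun _ _ => (N.integrable_linkFlow hx _ _).const_mul _]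
  refine Finset.sum_congr rfl fun _ _ => ?_
  rw [integral_const_mul, N.integral_linkFlow hx]

theorem integral_sumGE_outflow (hx : ∀ i j l, Integrable (fun ω => x ω i j l) μ) (i : V) (l : ℕ) :
    ∫ ω, N.sumGE (N.outflow (x ω) i) l ∂μ = N.sumGE (N.outflow (meanFlow μ x) i) l := by
  unfold sumGE
  rw [integral_finsetSum _ fun _ _ => N.integrable_outflow hx _ _]
  exact Finset.sum_congr rfl fun _ _ => N.integral_outflow hx _ _

theorem integral_sumGE_inflow (hx : ∀ i j l, Integrable (fun ω => x ω i j l) μ) (i : V) (l : ℕ) :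
    ∫ ω, N.sumGE (N.inflow (x ω) i) l ∂μ = N.sumGE (N.inflow (meanFlow μ x) i) l := by
  unfold sumGE
  rw [integral_finsetSum _ fun _ _ => N.integrable_inflow hx _ _]
  exact Finset.sum_congr rfl fun _ _ => N.integral_inflow hx _ _

end Expectations

/-! ### Long-term averages are determined by the flow assignment -/

section Averages

variable {μ : Measure Ω} {x : ℕ → Ω → FlowVar V} {f : FlowVar V}

theorem hasLongTermAvg_linkFlow (hx : ∀ t i j l, Integrable (fun ω => x t ω i j l) μ)
    (hf : IsFlowAssignment μ x f) (i j : V) :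
    HasLongTermAvg (fun t => ∫ ω, N.linkFlow (x t ω) i j ∂μ) (N.linkFlow f i j) := by
  simp_rw [fun t => N.integral_linkFlow (hx t)]
  exact .sum _ fun _ _ => hf _ _ _

theorem hasLongTermAvg_delivered (hx : ∀ t i j l, Integrable (fun ω => x t ω i j l) μ)
    (hf : IsFlowAssignment μ x f) :
    HasLongTermAvg (fun t => ∫ ω, N.delivered (x t ω) ∂μ) (N.delivered f) := by
  simp_rw [fun t => N.integral_delivered (hx t)]
  exact .sum _ fun _ _ => .sum _ fun _ _ => hf _ _ _

theorem hasLongTermAvg_cost (hx : ∀ t i j l, Integrable (fun ω => x t ω i j l) μ)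
    (hf : IsFlowAssignment μ x f) :
    HasLongTermAvg (fun t => ∫ ω, N.cost (x t ω) ∂μ) (N.cost f) := by
  simp_rw [fun t => N.integral_cost (hx t)]
  exact .sum _ fun _ _ => HasLongTermAvg.const_mul (.sum _ fun _ _ => hf _ _ _) _

theorem hasLongTermAvg_sumGE_outflow (hx : ∀ t i j l, Integrable (fun ω => x t ω i j l) μ)
    (hf : IsFlowAssignment μ x f) (i : V) (l : ℕ) :
    HasLongTermAvg (fun t => ∫ ω, N.sumGE (N.outflow (x t ω) i) l ∂μ)
      (N.sumGE (N.outflow f i) l) := by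
  simp_rw [fun t => N.integral_sumGE_outflow (hx t)]
  exact .sum _ fun _ _ => .sum _ fun _ _ => hf _ _ _

theorem hasLongTermAvg_sumGE_inflow (hx : ∀ t i j l, Integrable (fun ω => x t ω i j l) μ)
    (hf : IsFlowAssignment μ x f) (i : V) (l : ℕ) :
    HasLongTermAvg (fun t => ∫ ω, N.sumGE (N.inflow (x t ω) i) l ∂μ)
      (N.sumGE (N.inflow f i) l) := by
  simp_rw [fun t => N.integral_sumGE_inflow (hx t)]
  exact .sum _ fun _ _ => .sum _ fun _ _ => hf _ _ _

end Averages

/-! ### Arrivals and nonanticipation -/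

section Arrivals

variable {N} {μ : Measure Ω} {a : ℕ → Ω → V → ℕ → ℝ}

theorem IsArrivals.measurable_apply (ha : N.IsArrivals μ a) (t : ℕ) (i : V) (l : ℕ) :
    Measurable (fun ω => a t ω i l) :=
  (measurable_pi_apply l).comp ((measurable_pi_apply i).comp (ha.measurable t))

theorem IsArrivals.integrable [IsFiniteMeasure μ] (ha : N.IsArrivals μ a) (t : ℕ) (i : V) (l : ℕ) :
    Integrable (fun ω => a t ω i l) μ := by
  obtain ⟨A, hA⟩ := ha.bounded
  refine Integrable.of_bound (ha.measurable_apply t i l).aestronglyMeasurable A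
    (Eventually.of_forall fun ω => ?_)
  rw [Real.norm_of_nonneg (ha.nonneg t ω i l)]
  exact hA t ω i l

theorem IsArrivals.integral_eq_rate (ha : N.IsArrivals μ a) (t : ℕ) (i : V) (l : ℕ) :
    ∫ ω, a t ω i l ∂μ = rate μ a i l :=
  ((ha.ident t).comp (u := fun b : V → ℕ → ℝ => b i l)
    ((measurable_pi_apply l).comp (measurable_pi_apply i))).integral_eq

theorem IsArrivals.rate_nonneg (ha : N.IsArrivals μ a) (i : V) (l : ℕ) : 0 ≤ rate μ a i l :=
  integral_nonneg fun ω => ha.nonneg 0 ω i l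

/-- Decisions that are functions of the past arrivals do not anticipate. -/
theorem IsArrivals.nonanticipating (ha : N.IsArrivals μ a) {x : ℕ → Ω → FlowVar V}
    (hx : ∀ t, ∀ m : MeasurableSpace Ω, (∀ s < t, Measurable[m] (a s)) → Measurable[m] (x t))
    (t : ℕ) :
    Indep ((⨆ s, ⨆ (_ : s ≤ t), MeasurableSpace.comap (x s) inferInstance) ⊔
        (⨆ s, ⨆ (_ : s < t), MeasurableSpace.comap (a s) inferInstance))
      (⨆ s, ⨆ (_ : t ≤ s), MeasurableSpace.comap (a s) inferInstance) μ := by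
  have h := indep_iSup_of_disjoint (fun s => (ha.measurable s).comap_le) ha.indep
    (S := {s | s < t}) (T := {s | t ≤ s})
    (Set.disjoint_left.2 fun s (hs : s < t) (hs' : t ≤ s) => by omega)
  -- Quantifying over all σ-algebras `m` expresses dependence on the past alone; here `m` is the one
  -- generated by the arrivals before slot `t`, which absorbs the decisions up to `t`.
  refine indep_of_indep_of_le_left h (sup_le (iSup₂_le fun s hs => ?_) le_rfl)
  refine measurable_iff_comap_le.1 (hx s _ fun r hr => ?_)
  exact measurable_iff_comap_le.2 (le_iSup₂_of_le r (show r < t by omega) le_rfl)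

end Arrivals

/-! ### Integrability and expectation of backlogs -/

section Queues

variable {N} {μ : Measure Ω} [IsProbabilityMeasure μ] {a : ℕ → Ω → V → ℕ → ℝ}
  {x : ℕ → Ω → FlowVar V} {q₀ : V → ℕ → ℝ}

theorem queue_eq_zero (q₀ : V → ℕ → ℝ) (b : ℕ → V → ℕ → ℝ) (y : ℕ → FlowVar V) (t : ℕ) {i : V}
    {l : ℕ} (h : i = N.d ∨ l ∉ Finset.Icc 1 N.L) : N.queue q₀ b y t i l = 0 := by
  cases t <;> rw [queue, if_pos h]

/-- Asks for integrable decisions in slot `t` only, so that it can alternate with the bound of the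
decisions by the backlog in `AdmissibleOne.integrable`. -/
theorem integrable_queue_succ (ha : N.IsArrivals μ a) {t : ℕ}
    (hx : ∀ i j l, Integrable (fun ω => x t ω i j l) μ)
    (hQ : ∀ i l, Integrable
      (fun ω => N.queue q₀ (fun s => a s ω) (fun s => x s ω) t i l) μ) (i : V) (l : ℕ) :
    Integrable (fun ω => N.queue q₀ (fun s => a s ω) (fun s => x s ω) (t + 1) i l) μ := by
  by_cases h : i = N.d ∨ l ∉ Finset.Icc 1 N.L
  · simp [queue_eq_zero q₀ _ _ _ h]
  · simp only [queue, if_neg h]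
    exact (((hQ _ _).sub (N.integrable_outflow hx _ _)).add (N.integrable_inflow hx _ _)).add
      (ha.integrable _ _ _)

theorem integrable_queue_zero (i : V) (l : ℕ) :
    Integrable (fun ω => N.queue q₀ (fun s => a s ω) (fun s => x s ω) 0 i l) μ := by
  simp only [queue]
  exact integrable_const _

theorem integrable_queue (ha : N.IsArrivals μ a)
    (hx : ∀ t i j l, Integrable (fun ω => x t ω i j l) μ) (t : ℕ) (i : V) (l : ℕ) :
    Integrable (fun ω => N.queue q₀ (fun s => a s ω) (fun s => x s ω) t i l) μ := by
  induction t generalizing i l with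
  | zero => exact integrable_queue_zero i l
  | succ t ih => exact integrable_queue_succ ha (hx t) ih i l

/-- The expected backlogs are the backlogs of the expected arrivals and decisions. -/
theorem integral_queue (ha : N.IsArrivals μ a)
    (hx : ∀ t i j l, Integrable (fun ω => x t ω i j l) μ) (t : ℕ) (i : V) (l : ℕ) :
    ∫ ω, N.queue q₀ (fun s => a s ω) (fun s => x s ω) t i l ∂μ =
      N.queue q₀ (fun _ => rate μ a) (fun s => meanFlow μ (x s)) t i l := by
  induction t generalizing i l with
  | zero => simp [queue]
  | succ t ih =>
    by_cases h : i = N.d ∨ l ∉ Finset.Icc 1 N.L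
    · simp [queue_eq_zero q₀ _ _ _ h]
    · simp only [queue, if_neg h]
      have hQ := integrable_queue (q₀ := q₀) ha hx t i (l + 1)
      have ho := N.integrable_outflow (hx t) i (l + 1)
      have hi := N.integrable_inflow (hx t) i (l + 1)
      have hd : Integrable (fun ω => N.queue q₀ (fun s => a s ω) (fun s => x s ω) t i (l + 1) -
          N.outflow (x t ω) i (l + 1)) μ := hQ.sub ho
      rw [integral_add (by exact hd.add hi) (ha.integrable t i l), integral_add hd hi,
        integral_sub hQ ho, ih, N.integral_outflow (hx t), N.integral_inflow (hx t),
        ha.integral_eq_rate]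

end Queues

theorem IsPolicy.measurable_apply {N : RoutingNetwork V} {μ : Measure Ω}
    {a : ℕ → Ω → V → ℕ → ℝ} {x : ℕ → Ω → FlowVar V} (h : N.IsPolicy μ a x) (t : ℕ) (i j : V)
    (l : ℕ) : Measurable (fun ω => x t ω i j l) :=
  (measurable_pi_apply l).comp
    ((measurable_pi_apply j).comp ((measurable_pi_apply i).comp (h.measurable t)))

theorem outflow_nonneg {x : FlowVar V} (h : ∀ i j l, 0 ≤ x i j l) (i : V) (l : ℕ) :
    0 ≤ N.outflow x i l :=
  Finset.sum_nonneg fun _ _ => h _ _ _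

theorem inflow_nonneg {x : FlowVar V} (h : ∀ i j l, 0 ≤ x i j l) (i : V) (l : ℕ) :
    0 ≤ N.inflow x i l :=
  Finset.sum_nonneg fun _ _ => h _ _ _

theorem sumGE_nonneg {g : ℕ → ℝ} (h : ∀ l, 0 ≤ g l) (l : ℕ) : 0 ≤ N.sumGE g l :=
  Finset.sum_nonneg fun _ _ => h _

theorem le_outflow {x : FlowVar V} (h : ∀ i j l, 0 ≤ x i j l) {i j : V} (hij : (i, j) ∈ N.links)
    (l : ℕ) : x i j l ≤ N.outflow x i l :=
  Finset.single_le_sum (f := fun j => x i j l) (fun j _ => h i j l) (by simpa using hij)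

/-! ### Assignments of admissible policies are feasible -/

section FeasibleFlows

variable {N} {μ : Measure Ω} [IsProbabilityMeasure μ] {a : ℕ → Ω → V → ℕ → ℝ} {γ : ℝ}
  {x : ℕ → Ω → FlowVar V} {q₀ : V → ℕ → ℝ} {f : FlowVar V}

theorem AdmissibleTwo.integrable (h : N.AdmissibleTwo μ a γ x) (t : ℕ) (i j : V) (l : ℕ) :
    Integrable (fun ω => x t ω i j l) μ := by
  by_cases hs : (i, j) ∉ N.links ∨ l ∉ Finset.Icc 1 N.L
  · simp [fun ω => h.policy.support t ω i j l hs]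
  · push Not at hs
    refine Integrable.of_bound (h.policy.measurable_apply t i j l).aestronglyMeasurable (N.C i j)
      (Eventually.of_forall fun ω => ?_)
    rw [Real.norm_of_nonneg (h.policy.nonneg t ω i j l)]
    exact (Finset.single_le_sum (f := fun l => x t ω i j l)
      (fun l _ => h.policy.nonneg t ω i j l) hs.2).trans (h.capacity t ω i j hs.1)

theorem IsPolicy.assignment_nonneg (h : N.IsPolicy μ a x) (hf : IsFlowAssignment μ x f)
    (i j : V) (l : ℕ) : 0 ≤ f i j l :=
  (hf i j l).nonneg fun t => integral_nonneg fun ω => h.nonneg t ω i j l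

theorem IsFlowAssignment.eq_zero (hf : IsFlowAssignment μ x f) {i j : V} {l : ℕ}
    (h : ∀ t ω, x t ω i j l = 0) : f i j l = 0 :=
  (hf i j l).unique (by simpa [h] using HasLongTermAvg.of_const 0)

/-- The constraints are linear in the expected flows, and uniqueness of limits identifies the
averages they mention with functionals of `f`. -/
theorem AdmissibleTwo.isFeasibleFlow (h : N.AdmissibleTwo μ a γ x)
    (hf : IsFlowAssignment μ x f) : N.IsFeasibleFlow μ a γ f where
  nonneg := h.policy.assignment_nonneg hf
  support i j l hs := hf.eq_zero fun t ω => h.policy.support t ω i j l hs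
  reliability := by
    obtain ⟨c, hc, hle⟩ := h.reliability
    rwa [hc.unique (N.hasLongTermAvg_delivered h.integrable hf)] at hle
  capacity i j hij := by
    refine le_of_tendsto_of_tendsto' (N.hasLongTermAvg_linkFlow h.integrable hf i j)
      (HasLongTermAvg.of_const (N.C i j)) fun T => ?_
    refine mul_le_mul_of_nonneg_left (Finset.sum_le_sum fun t _ => ?_) (by positivity)
    refine (integral_mono (N.integrable_linkFlow (h.integrable t) i j) (integrable_const _)
      fun ω => h.capacity t ω i j hij).trans ?_
    simp
  causality i l hl := by
    obtain ⟨c, c', hc, hc', hle⟩ := h.causality i l hl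
    rwa [hc.unique (N.hasLongTermAvg_sumGE_outflow h.integrable hf i l),
      hc'.unique (N.hasLongTermAvg_sumGE_inflow h.integrable hf i (l + 1))] at hle
  sink k l := hf.eq_zero fun t ω => h.sink t ω k l

/-- There is no bound on the flows per slot in the capacity constraint here. Availability dominates
the decision by the current backlog, and that decision then controls the next backlog, so
integrability propagates in time. -/
theorem AdmissibleOne.integrable (ha : N.IsArrivals μ a) (h : N.AdmissibleOne μ q₀ a γ x)
    (t : ℕ) (i j : V) (l : ℕ) : Integrable (fun ω => x t ω i j l) μ := by
  have step : ∀ t, (∀ i l, Integrable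
      (fun ω => N.queue q₀ (fun s => a s ω) (fun s => x s ω) t i l) μ) →
      ∀ i j l, Integrable (fun ω => x t ω i j l) μ := by
    intro t hQ i j l
    by_cases hs : (i, j) ∉ N.links ∨ l ∉ Finset.Icc 1 N.L
    · simp [fun ω => h.policy.support t ω i j l hs]
    · push Not at hs
      refine (hQ i l).mono' (h.policy.measurable_apply t i j l).aestronglyMeasurable
        (Eventually.of_forall fun ω => ?_)
      rw [Real.norm_of_nonneg (h.policy.nonneg t ω i j l)]
      exact (N.le_outflow (h.policy.nonneg t ω) hs.1 l).trans (h.availability t ω i l hs.2)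
  have hQ : ∀ t i l, Integrable
      (fun ω => N.queue q₀ (fun s => a s ω) (fun s => x s ω) t i l) μ := by
    intro t
    induction t with
    | zero => exact integrable_queue_zero
    | succ t ih => exact integrable_queue_succ ha (step t ih) ih
  exact step t (hQ t) i j l

theorem AdmissibleOne.sink (h : N.AdmissibleOne μ q₀ a γ x) (t : ℕ) (ω : Ω) (k : V) (l : ℕ) :
    x t ω N.d k l = 0 := by
  by_cases hs : (N.d, k) ∉ N.links ∨ l ∉ Finset.Icc 1 N.L
  · exact h.policy.support t ω _ _ _ hs
  · push Not at hs
    have h1 := (N.le_outflow (h.policy.nonneg t ω) hs.1 l).trans (h.availability t ω _ l hs.2)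
    rw [queue_eq_zero q₀ _ _ _ (.inl rfl)] at h1
    exact le_antisymm h1 (h.policy.nonneg t ω _ _ _)

/-- Backlogs of lifetime at least `l` change by at most the causality surplus in each slot. -/
theorem sumGE_queue_succ_le {b : V → ℕ → ℝ} {y : ℕ → FlowVar V}
    (hy : ∀ t i j, y t i j (N.L + 1) = 0) {i : V} (hi : i ≠ N.d) {l : ℕ}
    (hl : l ∈ Finset.Icc 1 N.L) {t : ℕ}
    (hav : N.outflow (y t) i l ≤ N.queue q₀ (fun _ => b) y t i l) :
    N.sumGE (N.queue q₀ (fun _ => b) y (t + 1) i) l ≤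
      N.sumGE (N.queue q₀ (fun _ => b) y t i) l - N.sumGE (N.outflow (y t) i) l +
        (N.sumGE (N.inflow (y t) i) (l + 1) + N.sumGE (b i) l) := by
  have hl' := Finset.mem_Icc.1 hl
  have e : N.sumGE (N.queue q₀ (fun _ => b) y (t + 1) i) l =
      N.sumGE (N.queue q₀ (fun _ => b) y t i) (l + 1) - N.sumGE (N.outflow (y t) i) (l + 1) +
        N.sumGE (N.inflow (y t) i) (l + 1) + N.sumGE (b i) l := by
    rw [← N.sumGE_shift (N.queue q₀ (fun _ => b) y t i) (queue_eq_zero q₀ _ _ _ (.inr (by simp))),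
      ← N.sumGE_shift (N.outflow (y t) i) (by simp [outflow, hy]),
      ← N.sumGE_shift (N.inflow (y t) i) (by simp [inflow, hy])]
    simp only [sumGE, ← Finset.sum_sub_distrib, ← Finset.sum_add_distrib]
    refine Finset.sum_congr rfl fun k hk => ?_
    rw [queue, if_neg]
    simp only [Finset.mem_Icc] at hk ⊢
    push Not
    exact ⟨hi, by omega⟩
  -- What the inequality discards is the unsent backlog of lifetime exactly `l`, which ages below
  -- `l`; it is nonnegative by availability.
  rw [e, N.sumGE_eq_add (N.queue q₀ (fun _ => b) y t i) hl'.2,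
    N.sumGE_eq_add (N.outflow (y t) i) hl'.2]
  linarith

theorem AdmissibleOne.isFeasibleFlow (ha : N.IsArrivals μ a) (h : N.AdmissibleOne μ q₀ a γ x)
    (hf : IsFlowAssignment μ x f) : N.IsFeasibleFlow μ a γ f where
  nonneg := h.policy.assignment_nonneg hf
  support i j l hs := hf.eq_zero fun t ω => h.policy.support t ω i j l hs
  reliability := by
    obtain ⟨c, hc, hle⟩ := h.reliability
    rwa [hc.unique (N.hasLongTermAvg_delivered (h.integrable ha) hf)] at hle
  capacity i j hij := by
    obtain ⟨c, hc, hle⟩ := h.capacity i j hij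
    rwa [hc.unique (N.hasLongTermAvg_linkFlow (h.integrable ha) hf i j)] at hle
  causality i l hl := by
    have hx := h.integrable ha
    have hf0 := h.policy.assignment_nonneg hf
    by_cases hi : i = N.d
    -- The backlog recursion does not hold at the destination, but causality is trivial there
    -- because nothing is sent.
    · have h0 : N.sumGE (N.outflow f i) l = 0 := by
        simp [sumGE, outflow, hi, fun k l => hf.eq_zero fun t ω => h.sink t ω k l]
      rw [h0]
      exact add_nonneg (N.sumGE_nonneg (N.inflow_nonneg hf0 i) _)
        (N.sumGE_nonneg (ha.rate_nonneg i) _)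
    -- Taking expectations of availability leaves a deterministic system with constant arrivals.
    have hav : ∀ t, ∀ l ∈ Finset.Icc 1 N.L, N.outflow (meanFlow μ (x t)) i l ≤
        N.queue q₀ (fun _ => rate μ a) (fun s => meanFlow μ (x s)) t i l := by
      intro t l hl
      rw [← N.integral_outflow (hx t), ← integral_queue ha hx]
      exact integral_mono (N.integrable_outflow (hx t) i l) (integrable_queue ha hx t i l)
        fun ω => h.availability t ω i l hl
    have hm0 : ∀ t i j l, 0 ≤ meanFlow μ (x t) i j l := fun t i j l =>
      integral_nonneg fun ω => h.policy.nonneg t ω i j l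
    have hu : HasLongTermAvg (fun t => N.sumGE (N.inflow (meanFlow μ (x t)) i) (l + 1) +
        N.sumGE (rate μ a i) l) (N.sumGE (N.inflow f i) (l + 1) + N.sumGE (rate μ a i) l) := by
      have h1 := N.hasLongTermAvg_sumGE_inflow hx hf i (l + 1)
      simp_rw [fun t => N.integral_sumGE_inflow (hx t)] at h1
      refine (Tendsto.add h1 (HasLongTermAvg.of_const (N.sumGE (rate μ a i) l))).congr fun T => ?_
      rw [Finset.sum_add_distrib, mul_add]
    have hz := N.hasLongTermAvg_sumGE_outflow hx hf i l
    simp_rw [fun t => N.integral_sumGE_outflow (hx t)] at hz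
    refine hz.le_of_drift hu
      (S := fun t => N.sumGE (N.queue q₀ (fun _ => rate μ a) (fun s => meanFlow μ (x s)) t i) l)
      (fun t => Finset.sum_nonneg fun k hk => ?_) fun t => ?_
    -- The storage is nonnegative because each backlog dominates its own outflow.
    · refine (N.outflow_nonneg (hm0 t) i k).trans (hav t k ?_)
      simp only [Finset.mem_Icc] at hk hl ⊢
      omega
    · refine sumGE_queue_succ_le (fun t i j => ?_) hi hl (hav t l hl)
      simp [meanFlow, fun ω => h.policy.support t ω i j (N.L + 1) (.inr (by simp))]
  sink k l := hf.eq_zero fun t ω => h.sink t ω k l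

/-- A feasible flow assignment is achieved in the virtual network by the constant policy. -/
theorem IsFeasibleFlow.admissibleTwo (ha : N.IsArrivals μ a) (h : N.IsFeasibleFlow μ a γ f) :
    IsFlowAssignment μ (fun _ (_ : Ω) => f) f ∧ N.AdmissibleTwo μ a γ (fun _ _ => f) := by
  have hf : IsFlowAssignment μ (fun _ (_ : Ω) => f) f := fun i j l => by
    simpa using HasLongTermAvg.of_const (f i j l)
  have hx : ∀ (_ : ℕ) i j l, Integrable (fun _ : Ω => f i j l) μ := fun _ _ _ _ =>
    integrable_const _
  refine ⟨hf, ⟨fun _ => measurable_const, fun _ _ => h.nonneg, fun _ _ => h.support,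
    ha.nonanticipating fun _ _ _ => measurable_const⟩, ⟨f, hf⟩,
    ⟨_, N.hasLongTermAvg_delivered hx hf, h.reliability⟩, fun _ _ => h.capacity,
    fun i l hl => ⟨_, _, N.hasLongTermAvg_sumGE_outflow hx hf i l,
      N.hasLongTermAvg_sumGE_inflow hx hf i (l + 1), h.causality i l hl⟩, fun _ _ => h.sink⟩

end FeasibleFlows

/-! ### Realizing a feasible flow in the original network -/

section ProportionalPolicy

/-- The decision that sends the fraction `r i j l` of each backlog over each link. -/
def splitFlow (r : FlowVar V) (Q : V → ℕ → ℝ) : FlowVar V := fun i j l => r i j l * Q i l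

/-- The backlogs when the fractions `r i j l` of the backlogs are sent in each slot. -/
def splitQueue (q₀ : V → ℕ → ℝ) (r : FlowVar V) (b : ℕ → V → ℕ → ℝ) : ℕ → V → ℕ → ℝ
  | 0, i, l => if i = N.d ∨ l ∉ Finset.Icc 1 N.L then 0 else q₀ i l
  | t + 1, i, l =>
      if i = N.d ∨ l ∉ Finset.Icc 1 N.L then 0
      else splitQueue q₀ r b t i (l + 1)
        - N.outflow (splitFlow r (splitQueue q₀ r b t)) i (l + 1)
        + N.inflow (splitFlow r (splitQueue q₀ r b t)) i (l + 1) + b t i l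

/-- The steady backlogs of the fluid model with constant flow `f` and arrival rates `b`. -/
def fluidQueue (b : V → ℕ → ℝ) (f : FlowVar V) (i : V) (l : ℕ) : ℝ :=
  N.sumGE (N.inflow f i) (l + 1) - N.sumGE (N.outflow f i) (l + 1) + N.sumGE (b i) l

/-- The fractions of the steady backlogs of the fluid model that the flow `f` sends. -/
noncomputable def fluidFraction (b : V → ℕ → ℝ) (f : FlowVar V) : FlowVar V :=
  fun i j l => f i j l / N.fluidQueue b f i l

variable {N}

/-- Decisions depend on backlogs, which depend on earlier decisions; this resolves the circularity
by identifying the closed-loop recursion with the true backlogs. -/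
theorem queue_splitFlow (q₀ : V → ℕ → ℝ) (r : FlowVar V) (b : ℕ → V → ℕ → ℝ) (t : ℕ) :
    N.queue q₀ b (fun s => splitFlow r (N.splitQueue q₀ r b s)) t = N.splitQueue q₀ r b t := by
  induction t with
  | zero => funext i l; rw [queue, splitQueue]
  | succ t ih => funext i l; rw [queue, splitQueue, ih]

theorem splitQueue_eq_zero (q₀ : V → ℕ → ℝ) (r : FlowVar V) (b : ℕ → V → ℕ → ℝ) (t : ℕ) {i : V}
    {l : ℕ} (h : i = N.d ∨ l ∉ Finset.Icc 1 N.L) : N.splitQueue q₀ r b t i l = 0 := by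
  cases t <;> rw [splitQueue, if_pos h]

theorem measurable_splitFlow {r : FlowVar V} {Q : Ω → V → ℕ → ℝ}
    (hQ : ∀ i l, Measurable fun ω => Q ω i l) : Measurable fun ω => splitFlow r (Q ω) :=
  measurable_pi_lambda _ fun i => measurable_pi_lambda _ fun j => measurable_pi_lambda _ fun l =>
    (hQ i l).const_mul (r i j l)

/-- The σ-algebra on `Ω` is free and only arrivals before `t` are used, so this also yields
measurability with respect to the past. -/
theorem measurable_splitQueue (q₀ : V → ℕ → ℝ) (r : FlowVar V) {a : ℕ → Ω → V → ℕ → ℝ} {t : ℕ}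
    (ha : ∀ s < t, Measurable (a s)) (i : V) (l : ℕ) :
    Measurable fun ω => N.splitQueue q₀ r (fun s => a s ω) t i l := by
  induction t generalizing i l with
  | zero => simp only [splitQueue]; exact measurable_const
  | succ t ih =>
    have hQ := ih fun s hs => ha s (by omega)
    by_cases h : i = N.d ∨ l ∉ Finset.Icc 1 N.L
    · simp only [splitQueue, if_pos h]; exact measurable_const
    · simp only [splitQueue, if_neg h, outflow, inflow, splitFlow]
      have h1 : Measurable fun ω => a t ω i l :=
        (measurable_pi_apply l).comp ((measurable_pi_apply i).comp (ha t (by omega)))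
      exact (((hQ _ _).sub (Finset.measurable_sum _ fun _ _ => (hQ _ _).const_mul _)).add
        (Finset.measurable_sum _ fun _ _ => (hQ _ _).const_mul _)).add h1

theorem outflow_splitFlow (r : FlowVar V) (Q : V → ℕ → ℝ) (i : V) (l : ℕ) :
    N.outflow (splitFlow r Q) i l = N.outflow r i l * Q i l := by
  simp only [outflow, splitFlow, Finset.sum_mul]

theorem splitQueue_nonneg {q₀ : V → ℕ → ℝ} (hq₀ : ∀ i l, 0 ≤ q₀ i l) {r : FlowVar V}
    (hr : ∀ i j l, 0 ≤ r i j l) (hr1 : ∀ i l, N.outflow r i l ≤ 1) {b : ℕ → V → ℕ → ℝ}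
    (hb : ∀ t i l, 0 ≤ b t i l) (t : ℕ) (i : V) (l : ℕ) : 0 ≤ N.splitQueue q₀ r b t i l := by
  induction t generalizing i l with
  | zero => rw [splitQueue]; split_ifs; exacts [le_rfl, hq₀ i l]
  | succ t ih =>
    rw [splitQueue]
    split_ifs
    · exact le_rfl
    · have h1 := N.inflow_nonneg (x := splitFlow r (N.splitQueue q₀ r b t))
        (fun i j l => mul_nonneg (hr i j l) (ih i l)) i (l + 1)
      have h2 := mul_le_of_le_one_left (ih i (l + 1)) (hr1 i (l + 1))
      rw [outflow_splitFlow]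
      linarith [hb t i l]

theorem integrable_splitQueue {μ : Measure Ω} [IsProbabilityMeasure μ] {a : ℕ → Ω → V → ℕ → ℝ}
    (ha : N.IsArrivals μ a) (q₀ : V → ℕ → ℝ) (r : FlowVar V) (t : ℕ) (i : V) (l : ℕ) :
    Integrable (fun ω => N.splitQueue q₀ r (fun s => a s ω) t i l) μ := by
  induction t generalizing i l with
  | zero => simp only [splitQueue]; exact integrable_const _
  | succ t ih =>
    have h := integrable_queue_succ (q₀ := q₀) (t := t)
      (x := fun t ω => splitFlow r (N.splitQueue q₀ r (fun s => a s ω) t)) ha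
      (fun i j l => (ih i l).const_mul _) (by simpa only [queue_splitFlow] using ih) i l
    simpa only [queue_splitFlow] using h

theorem meanFlow_splitFlow (μ : Measure Ω) (r : FlowVar V) (Q : Ω → V → ℕ → ℝ) :
    meanFlow μ (fun ω => splitFlow r (Q ω)) = splitFlow r (fun i l => ∫ ω, Q ω i l ∂μ) := by
  funext i j l
  exact integral_const_mul _ _

/-- The closed-loop recursion is linear with deterministic coefficients, so expectation passes
through it. -/
theorem integral_splitQueue {μ : Measure Ω} [IsProbabilityMeasure μ] {a : ℕ → Ω → V → ℕ → ℝ}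
    (ha : N.IsArrivals μ a) (q₀ : V → ℕ → ℝ) (r : FlowVar V) (t : ℕ) :
    (fun i l => ∫ ω, N.splitQueue q₀ r (fun s => a s ω) t i l ∂μ) =
      N.splitQueue q₀ r (fun _ => rate μ a) t := by
  have hx : ∀ t i j l, Integrable
      (fun ω => splitFlow r (N.splitQueue q₀ r (fun s => a s ω) t) i j l) μ :=
    fun t i j l => (integrable_splitQueue ha q₀ r t i l).const_mul _
  have h : ∀ t i l, ∫ ω, N.splitQueue q₀ r (fun s => a s ω) t i l ∂μ =
      N.queue q₀ (fun _ => rate μ a) (fun s => splitFlow r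
        (fun i l => ∫ ω, N.splitQueue q₀ r (fun s => a s ω) s i l ∂μ)) t i l := by
    intro t i l
    have h1 := integral_queue (q₀ := q₀) ha hx t i l
    simp_rw [queue_splitFlow, meanFlow_splitFlow] at h1
    exact h1
  induction t with
  | zero => funext i l; rw [h, queue, splitQueue]
  | succ t ih =>
    funext i l
    rw [h, queue, splitQueue, ih]
    -- Combined with `ih`, this identifies the open-loop backlog still left in the goal with the
    -- closed-loop one.
    have h2 := funext fun i => funext fun l => h t i l
    rw [ih] at h2
    rw [← h2]

variable {μ : Measure Ω} {a : ℕ → Ω → V → ℕ → ℝ} {γ : ℝ} {f : FlowVar V} {q₀ : V → ℕ → ℝ}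

/-- This is causality with the terms of lifetime above `l` moved to the other side; at `l = L + 1`
both sides vanish. -/
theorem IsFeasibleFlow.outflow_le (h : N.IsFeasibleFlow μ a γ f) (i : V) {l : ℕ}
    (hl : l ∈ Finset.Icc 1 (N.L + 1)) : N.outflow f i l ≤ N.fluidQueue (rate μ a) f i l := by
  rw [Finset.mem_Icc] at hl
  rcases eq_or_lt_of_le hl.2 with rfl | hlt
  · simp [fluidQueue, N.sumGE_of_lt _ (show N.L < N.L + 1 by omega),
      N.sumGE_of_lt _ (show N.L < N.L + 1 + 1 by omega), outflow,
      fun i j => h.support i j (N.L + 1) (.inr (by simp))]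
  · have h1 := h.causality i l (by rw [Finset.mem_Icc]; omega)
    rw [N.sumGE_eq_add (N.outflow f i) (by omega)] at h1
    rw [fluidQueue]
    linarith

theorem IsFeasibleFlow.fluidFraction_mul (h : N.IsFeasibleFlow μ a γ f) (i j : V) {l : ℕ}
    (hl : l ∈ Finset.Icc 1 (N.L + 1)) :
    N.fluidFraction (rate μ a) f i j l * N.fluidQueue (rate μ a) f i l = f i j l := by
  -- If the steady backlog is 0, the flow lies between 0 and the backlog, so the convention for
  -- division by zero does no harm.
  refine div_mul_cancel_of_imp fun h0 => ?_
  by_cases hij : (i, j) ∈ N.links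
  · have h1 := (N.le_outflow h.nonneg hij l).trans (h.outflow_le i hl)
    exact le_antisymm (h0 ▸ h1) (h.nonneg i j l)
  · exact h.support i j l (.inl hij)

theorem IsFeasibleFlow.fluidFraction_nonneg (h : N.IsFeasibleFlow μ a γ f) (i j : V) (l : ℕ) :
    0 ≤ N.fluidFraction (rate μ a) f i j l := by
  by_cases hl : l ∈ Finset.Icc 1 N.L
  · refine div_nonneg (h.nonneg i j l) ((N.outflow_nonneg h.nonneg i l).trans (h.outflow_le i ?_))
    rw [Finset.mem_Icc] at hl ⊢
    omega
  · simp [fluidFraction, h.support i j l (.inr hl)]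

theorem IsFeasibleFlow.outflow_fluidFraction_le (h : N.IsFeasibleFlow μ a γ f) (i : V) (l : ℕ) :
    N.outflow (N.fluidFraction (rate μ a) f) i l ≤ 1 := by
  have e : N.outflow (N.fluidFraction (rate μ a) f) i l =
      N.outflow f i l / N.fluidQueue (rate μ a) f i l := by
    simp only [outflow, fluidFraction, Finset.sum_div]
  rw [e]
  by_cases hl : l ∈ Finset.Icc 1 N.L
  · have hle := h.outflow_le i (l := l) (by rw [Finset.mem_Icc] at hl ⊢; omega)
    exact div_le_one_of_le₀ hle ((N.outflow_nonneg h.nonneg i l).trans hle)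
  · simp [outflow, fun j => h.support i j l (.inr hl)]

/-- The steady profile is a fixed point of the backlog recursion with constant flow. -/
theorem fluidQueue_eq (hL : ∀ i j, f i j (N.L + 1) = 0) (b : V → ℕ → ℝ) (i : V) {l : ℕ}
    (hl : l ≤ N.L) :
    N.fluidQueue b f i l = N.fluidQueue b f i (l + 1) - N.outflow f i (l + 1) +
      N.inflow f i (l + 1) + b i l := by
  unfold fluidQueue
  rw [N.sumGE_eq_add (b i) hl]
  rcases eq_or_lt_of_le hl with rfl | hlt
  · simp [N.sumGE_of_lt _ (show N.L < N.L + 1 by omega),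
      N.sumGE_of_lt _ (show N.L < N.L + 1 + 1 by omega), outflow, inflow, hL]
  · rw [N.sumGE_eq_add (N.inflow f i) hlt, N.sumGE_eq_add (N.outflow f i) hlt]
    ring

/-- The actual backlog of the destination is 0 while the fluid formula counts what was delivered;
the mismatch is harmless because `f` sends nothing from there. -/
theorem IsFeasibleFlow.splitFlow_eq (h : N.IsFeasibleFlow μ a γ f) {Q : V → ℕ → ℝ} {l : ℕ}
    (hl : l ∈ Finset.Icc 1 (N.L + 1))
    (hQ : ∀ i, i ≠ N.d → Q i l = N.fluidQueue (rate μ a) f i l) (i j : V) :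
    splitFlow (N.fluidFraction (rate μ a) f) Q i j l = f i j l := by
  by_cases hi : i = N.d
  · simp [splitFlow, fluidFraction, hi, h.sink]
  · rw [splitFlow, hQ i hi, h.fluidFraction_mul i j hl]

/-- With constant arrivals, the proportional policy reaches the steady state in finite time. -/
theorem IsFeasibleFlow.splitQueue_eq (h : N.IsFeasibleFlow μ a γ f) (t : ℕ) (i : V)
    (hi : i ≠ N.d) (l : ℕ) (hl : l ∈ Finset.Icc 1 (N.L + 1)) (ht : N.L < l + t) :
    N.splitQueue q₀ (N.fluidFraction (rate μ a) f) (fun _ => rate μ a) t i l =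
      N.fluidQueue (rate μ a) f i l := by
  have hl' := Finset.mem_Icc.1 hl
  rcases eq_or_lt_of_le hl'.2 with rfl | hlt
  · rw [splitQueue_eq_zero _ _ _ _ (.inr (by simp))]
    simp [fluidQueue, N.sumGE_of_lt _ (show N.L < N.L + 1 by omega),
      N.sumGE_of_lt _ (show N.L < N.L + 1 + 1 by omega)]
  -- The steady state spreads downwards from the empty lifetime `L + 1`, one lifetime per slot,
  -- reaching `l` after `L + 1 - l` slots whatever `q₀` is.
  induction t generalizing i l with
  | zero => omega
  | succ t ih =>
    have hl1 : l + 1 ∈ Finset.Icc 1 (N.L + 1) := by rw [Finset.mem_Icc]; omega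
    have hQ : ∀ i, i ≠ N.d →
        N.splitQueue q₀ (N.fluidFraction (rate μ a) f) (fun _ => rate μ a) t i (l + 1) =
          N.fluidQueue (rate μ a) f i (l + 1) := by
      intro i hi
      rcases eq_or_lt_of_le (show l + 1 ≤ N.L + 1 by omega) with he | hlt1
      · rw [splitQueue_eq_zero _ _ _ _ (.inr (by simp [he]))]
        simp [fluidQueue, N.sumGE_of_lt _ (show N.L < l + 1 by omega),
          N.sumGE_of_lt _ (show N.L < l + 1 + 1 by omega)]
      · exact ih i hi (l + 1) hl1 (by omega) (Finset.mem_Icc.1 hl1) hlt1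
    rw [splitQueue, if_neg (by simp only [Finset.mem_Icc]; push Not; exact ⟨hi, by omega⟩),
      fluidQueue_eq (fun i j => h.support i j _ (.inr (by simp))) _ _ (by omega), hQ i hi]
    simp only [outflow, inflow, h.splitFlow_eq hl1 hQ]

/-- A feasible flow assignment is achieved in the original network by the proportional policy. -/
theorem IsFeasibleFlow.admissibleOne [IsProbabilityMeasure μ] (ha : N.IsArrivals μ a)
    (hq₀ : ∀ i l, 0 ≤ q₀ i l) (h : N.IsFeasibleFlow μ a γ f) :
    ∃ x : ℕ → Ω → FlowVar V, IsFlowAssignment μ x f ∧ N.AdmissibleOne μ q₀ a γ x := by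
  set r := N.fluidFraction (rate μ a) f with hr
  let x : ℕ → Ω → FlowVar V := fun t ω => splitFlow r (N.splitQueue q₀ r (fun s => a s ω) t)
  have hQ : ∀ t ω i l, 0 ≤ N.splitQueue q₀ r (fun s => a s ω) t i l := fun t ω =>
    splitQueue_nonneg hq₀ h.fluidFraction_nonneg h.outflow_fluidFraction_le
      (fun s => ha.nonneg s ω) t
  have hx : ∀ t i j l, Integrable (fun ω => x t ω i j l) μ :=
    fun t i j l => (integrable_splitQueue ha q₀ r t i l).const_mul _
  have hmeas : ∀ t, ∀ m : MeasurableSpace Ω, (∀ s < t, Measurable[m] (a s)) →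
      Measurable[m] (x t) := fun t m hm =>
    @measurable_splitFlow V _ _ Ω m r _ (@measurable_splitQueue V _ _ N Ω m q₀ r a t hm)
  have hsupp : ∀ t ω i j l, (i, j) ∉ N.links ∨ l ∉ Finset.Icc 1 N.L → x t ω i j l = 0 := by
    intro t ω i j l hs
    simp [x, splitFlow, hr, fluidFraction, h.support i j l hs]
  have hf : IsFlowAssignment μ x f := by
    intro i j l
    by_cases hs : (i, j) ∉ N.links ∨ l ∉ Finset.Icc 1 N.L
    · simpa [hsupp _ _ i j l hs, h.support i j l hs] using HasLongTermAvg.of_const 0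
    push Not at hs
    have hl : l ∈ Finset.Icc 1 (N.L + 1) := by
      have := hs.2
      rw [Finset.mem_Icc] at this ⊢
      omega
    -- From slot `L` on, every lifetime `l ≥ 1` satisfies `L < l + t`, so the expected flow is
    -- exactly `f`.
    refine .of_tendsto (tendsto_atTop_of_eventually_const (i₀ := N.L) fun t ht => ?_)
    have e := congrFun (congrFun (congrFun (meanFlow_splitFlow μ r
      (fun ω => N.splitQueue q₀ r (fun s => a s ω) t)) i) j) l
    rw [integral_splitQueue ha] at e
    rw [← h.splitFlow_eq hl (fun i hi => h.splitQueue_eq (q₀ := q₀) t i hi l hl (by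
      have := (Finset.mem_Icc.1 hl).1
      omega)) i j]
    exact e
  refine ⟨x, hf, ⟨fun t => hmeas t _ fun s _ => ha.measurable s,
    fun t ω i j l => mul_nonneg (h.fluidFraction_nonneg i j l) (hQ t ω i l), hsupp,
    ha.nonanticipating hmeas⟩, ⟨f, hf⟩, ⟨_, N.hasLongTermAvg_delivered hx hf, h.reliability⟩,
    fun i j hij => ⟨_, N.hasLongTermAvg_linkFlow hx hf i j, h.capacity i j hij⟩, ?_⟩
  intro t ω i l _
  -- Availability on each path: a total fraction at most 1 of a nonnegative backlog is sent.
  rw [queue_splitFlow, outflow_splitFlow]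
  exact mul_le_of_le_one_left (hQ t ω i l) (h.outflow_fluidFraction_le i l)

end ProportionalPolicy

/-! ### Both sets of achieved costs are the costs of the feasible flows -/

theorem achievedCosts_admissibleOne {μ : Measure Ω} [IsProbabilityMeasure μ]
    {a : ℕ → Ω → V → ℕ → ℝ} (ha : N.IsArrivals μ a) {q₀ : V → ℕ → ℝ} (hq₀ : ∀ i l, 0 ≤ q₀ i l)
    (γ : ℝ) : N.achievedCosts μ (N.AdmissibleOne μ q₀ a γ) =
      N.cost '' {f | N.IsFeasibleFlow μ a γ f} := by
  ext c
  constructor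
  · rintro ⟨x, hx, hc⟩
    obtain ⟨f, hf⟩ := hx.assignment
    exact ⟨f, hx.isFeasibleFlow ha hf, (N.hasLongTermAvg_cost (hx.integrable ha) hf).unique hc⟩
  · rintro ⟨f, h, rfl⟩
    obtain ⟨x, hf, hx⟩ := IsFeasibleFlow.admissibleOne ha hq₀ h
    exact ⟨x, hx, N.hasLongTermAvg_cost (hx.integrable ha) hf⟩

theorem achievedCosts_admissibleTwo {μ : Measure Ω} [IsProbabilityMeasure μ]
    {a : ℕ → Ω → V → ℕ → ℝ} (ha : N.IsArrivals μ a) (γ : ℝ) :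
    N.achievedCosts μ (N.AdmissibleTwo μ a γ) = N.cost '' {f | N.IsFeasibleFlow μ a γ f} := by
  ext c
  constructor
  · rintro ⟨x, hx, hc⟩
    obtain ⟨f, hf⟩ := hx.assignment
    exact ⟨f, hx.isFeasibleFlow hf, (N.hasLongTermAvg_cost hx.integrable hf).unique hc⟩
  · rintro ⟨f, h, rfl⟩
    obtain ⟨hf, hx⟩ := IsFeasibleFlow.admissibleTwo ha h
    exact ⟨_, hx, N.hasLongTermAvg_cost hx.integrable hf⟩

end RoutingNetwork

theorem corollary1 {V : Type*} [Fintype V] [DecidableEq V] (N : RoutingNetwork V)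
    {Ω : Type*} [MeasurableSpace Ω] (μ : Measure Ω) [IsProbabilityMeasure μ]
    (a : ℕ → Ω → V → ℕ → ℝ) (ha : N.IsArrivals μ a)
    (q₀ : V → ℕ → ℝ) (hq₀ : ∀ i l, 0 ≤ q₀ i l) (γ : ℝ) :
    N.optimalValue μ (N.AdmissibleOne μ q₀ a γ) = N.optimalValue μ (N.AdmissibleTwo μ a γ) ∧
    ∀ v : ℝ, IsLeast (N.achievedCosts μ (N.AdmissibleOne μ q₀ a γ)) v ↔
      IsLeast (N.achievedCosts μ (N.AdmissibleTwo μ a γ)) v := by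
  have h : N.achievedCosts μ (N.AdmissibleOne μ q₀ a γ) =
      N.achievedCosts μ (N.AdmissibleTwo μ a γ) := by
    rw [N.achievedCosts_admissibleOne ha hq₀, N.achievedCosts_admissibleTwo ha]
  exact ⟨by rw [RoutingNetwork.optimalValue, RoutingNetwork.optimalValue, h], fun v => by rw [h]⟩
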